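/- Let $\mathbb K$ be a Hardy field (a field of germs at $+\infty$ of real functions, closed under differentiation) whose elements are germs of functions definable in a fixed polynomially bounded o-minimal expansion of the real field, and which contains the germ of $t\mapsto t^r$ for every $r\in\mathbb R$. For $f\in\mathbb K$ let $\operatorname{val} f=\lim_{t\to\infty}\log|f(t)|/\log t\in\mathbb R\cup\{-\infty\}$, with $\operatorname{val}0=-\infty$. For a $d\times m$ matrix $B$ with entries in $\mathbb R\cup\{-\infty\}$, a lift of $B$ is a matrix $\boldsymbol B=(\boldsymbol b_{ij})\in\mathbb K^{d\times m}$ with nonnegative entries such that $\operatorname{val}\boldsymbol b_{ij}=b_{ij}$ for all $i,j$. The upper dequantized tropical volume of $B$ is $$\operatorname{qvol}^+(B)=\sup\{\operatorname{val}(\operatorname{vol}\boldsymbol B)\mid \boldsymbol B\text{ is a lift of }B\},$$ where $\operatorname{vol}\boldsymbol B$ is the germ of $t\mapsto\operatorname{vol}\operatorname{conv}\boldsymbol B(t)$, the $d$-dimensional Lebesgue measure of the convex hull of the columns of $\boldsymbol B(t)$. Theorem. Let $A=(a_{ij})\in\mathbb R_{\ge0}^{d\times m}$, let $\operatorname{Log}A=(\log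 a_{ij})$ with $\log 0=-\infty$, and let $\operatorname{conv}A\subset\mathbb R^d$ be the convex hull of the columns of $A$. Let $T$ be an arbitrary triangulation of the point configuration given by the columns of $A$ (a geometric simplicial complex with vertices among the columns, whose union is $\operatorname{conv}A$), and let $\alpha$ be its number of maximal cells. Then $\alpha$ is finite, $\operatorname{qvol}^+(\operatorname{Log}A)<+\infty$, and $$\operatorname{vol}\operatorname{conv}A\ \le\ \alpha\,(d+1)\,\exp\bigl(\operatorname{qvol}^+(\operatorname{Log}A)\bigr),$$ where $\exp(-\infty)=0$. -/

import Mathlib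

open Filter Topology MeasureTheory
open scoped ENNReal

universe u v

noncomputable section

/-- A first-order structure with underlying set `ℝ` is an o-minimal expansion of the real field:
the order and the graphs of addition and multiplication are definable, and every definable
(with real parameters) subset of the line is a finite union of intervals. An order-connected
subset of `ℝ` is an interval, possibly empty, a point, or unbounded. -/
structure IsOMinimalRealExpansion (L : FirstOrder.Language.{u, v}) [L.Structure ℝ] : Prop where
  definable_lt : (Set.univ : Set ℝ).Definable₂ L {p : ℝ × ℝ | p.1 < p.2}
  definable_add : (Set.univ : Set ℝ).Definable L {x : Fin 3 → ℝ | x 0 + x 1 = x 2}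
  definable_mul : (Set.univ : Set ℝ).Definable L {x : Fin 3 → ℝ | x 0 * x 1 = x 2}
  finite_union : ∀ s : Set ℝ, (Set.univ : Set ℝ).Definable₁ L s →
    ∃ F : Set (Set ℝ), F.Finite ∧ (∀ I ∈ F, I.OrdConnected) ∧ s = ⋃₀ F

/-- A function `ℝ → ℝ` is definable (with real parameters) if its graph is. -/
def IsDefinableRealFun (L : FirstOrder.Language.{u, v}) [L.Structure ℝ] (f : ℝ → ℝ) : Prop :=
  (Set.univ : Set ℝ).Definable₂ L {p : ℝ × ℝ | f p.1 = p.2}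

/-- Every definable function `ℝ → ℝ` is eventually bounded by a power of the variable. -/
def IsPolynomiallyBounded (L : FirstOrder.Language.{u, v}) [L.Structure ℝ] : Prop :=
  ∀ f : ℝ → ℝ, IsDefinableRealFun L f → ∃ n : ℕ, ∀ᶠ t in atTop, |f t| ≤ t ^ n

/-- A Hardy field: a ring of germs at `+∞` of real functions that is a field and is closed under
differentiation (in particular every element has an eventually differentiable representative). -/
structure IsHardyField (K : Subring (Germ (atTop : Filter ℝ) ℝ)) : Prop where
  exists_inv : ∀ x ∈ K, x ≠ 0 → ∃ y ∈ K, x * y = 1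
  deriv_mem : ∀ f : ℝ → ℝ, (f : Germ (atTop : Filter ℝ) ℝ) ∈ K →
    (∀ᶠ t in atTop, DifferentiableAt ℝ f t) ∧ (deriv f : Germ (atTop : Filter ℝ) ℝ) ∈ K

/-- The fields over which lifts are taken: Hardy fields consisting of germs at `+∞` of functions
definable in the structure given by `L`, and containing all real powers of the variable. -/
structure IsDefinableHardyField (L : FirstOrder.Language.{u, v}) [L.Structure ℝ]
    (K : Subring (Germ (atTop : Filter ℝ) ℝ)) : Prop extends IsHardyField K where
  exists_definable : ∀ x ∈ K, ∃ f : ℝ → ℝ,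
    IsDefinableRealFun L f ∧ (f : Germ (atTop : Filter ℝ) ℝ) = x
  rpow_mem : ∀ r : ℝ, ((fun t : ℝ => t ^ r : ℝ → ℝ) : Germ (atTop : Filter ℝ) ℝ) ∈ K

/-- The archimedean valuation `log |x|`, with value `-∞ = ⊥` at `x = 0`. The tropical numbers
`ℝ ∪ {-∞}` are viewed inside `EReal`. -/
def logAbs (x : ℝ) : EReal := ENNReal.log (ENNReal.ofReal |x|)

/-- The entrywise archimedean valuation of a real matrix. -/
def matrixLog {d m : ℕ} (A : Matrix (Fin d) (Fin m) ℝ) : Matrix (Fin d) (Fin m) EReal :=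
  A.map logAbs

/-- The non-archimedean valuation `val f = lim_{t → ∞} log |f t| / log t` exists and equals `a`
(so `val 0 = ⊥`). It depends only on the germ of `f` at `+∞`. -/
def HasVal (f : ℝ → ℝ) (a : EReal) : Prop :=
  Tendsto (fun t : ℝ => logAbs (f t) / ((Real.log t : ℝ) : EReal)) atTop (𝓝 a)

/-- The convex hull of the columns of a matrix. -/
def convColumns {d m : ℕ} (A : Matrix (Fin d) (Fin m) ℝ) : Set (Fin d → ℝ) :=
  convexHull ℝ (Set.range A.col)

/-- The parametric family of matrices `F` represents a lift of the tropical matrix `A`: a matrix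
with nonnegative entries in `K` whose entrywise valuation is `A`. -/
def IsLift {d m : ℕ} (K : Subring (Germ (atTop : Filter ℝ) ℝ))
    (F : ℝ → Matrix (Fin d) (Fin m) ℝ) (A : Matrix (Fin d) (Fin m) EReal) : Prop :=
  ∀ i j, ((fun t => F t i j : ℝ → ℝ) : Germ (atTop : Filter ℝ) ℝ) ∈ K ∧
    (∀ᶠ t in atTop, 0 ≤ F t i j) ∧ HasVal (fun t => F t i j) (A i j)

/-- The upper dequantized tropical volume of `A` (with respect to `K`): the supremum of the
valuations of the volumes of the lifts of `A`. The volume of the polytope spanned over `K` by the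
columns of a lift is the germ of the function that maps `t` to the volume of the real polytope
spanned by the columns of the lift evaluated at `t`. -/
def qvolPlus {d m : ℕ} (K : Subring (Germ (atTop : Filter ℝ) ℝ))
    (A : Matrix (Fin d) (Fin m) EReal) : EReal :=
  sSup {a : EReal | ∃ F : ℝ → Matrix (Fin d) (Fin m) ℝ, IsLift K F A ∧
    HasVal (fun t => (volume (convColumns (F t))).toReal) a}

/-- `T` is a triangulation of the point configuration given by the columns of `A`: a geometric
simplicial complex with vertices among the columns, covering their convex hull. -/
def IsTriangulation {d m : ℕ} (A : Matrix (Fin d) (Fin m) ℝ)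
    (T : Geometry.SimplicialComplex ℝ (Fin d → ℝ)) : Prop :=
  T.vertices ⊆ Set.range A.col ∧ T.space = convColumns A

end

/-! By subadditivity over the maximal cells, it suffices to bound the volume of one simplex spanned
by `d + 1` columns by `(d + 1) * exp qvol⁺`. That volume is `|det H| / d!`, where `H` is the matrix
of vertices with a row of ones on top. Let `P` be the largest permutation product in the Leibniz
expansion of `det H`. As `H` is nonnegative, `|det H| ≤ (d + 1)! P`, so the simplex has volume at
most `(d + 1) P`.

It remains to see that `log P ≤ qvol⁺` when `P > 0`. Lift `a_ij` to `c_ij t ^ log a_ij`, with `c_ij`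
large on the entries chosen by an optimal permutation. The optimal term then dominates the lifted
determinant, ties included, so nothing cancels and the lifted volume grows at least like `t ^ log
P`.

The supremum ranges only over lifts whose volume has a valuation, so existence must be shown too: up
to constants, the volume is the sum of `|det|` over all `(d + 1)`-tuples of columns, and each
summand is the absolute value of a generalized polynomial in `t`. -/

/-! ### Volume of the corner simplex -/

/-- The convex hull of the origin and the standard basis vectors. -/
def cornerSimplex (d : ℕ) : Set (Fin d → ℝ) :=
  convexHull ℝ (Set.range (Fin.cons 0 (fun i => Pi.single i 1) : Fin (d + 1) → Fin d → ℝ))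

theorem cornerSimplex_subset (d : ℕ) :
    cornerSimplex d ⊆ {x | (∀ i, 0 ≤ x i) ∧ ∑ i, x i ≤ 1} := by
  apply convexHull_min
  · rintro _ ⟨j, rfl⟩
    refine Fin.cases ?_ (fun i => ?_) j
    · simp
    · constructor
      · intro k
        simp only [Fin.cons_succ, Pi.single_apply]
        split_ifs <;> norm_num
      · simp
  · intro x hx y hy a b ha hb hab
    refine ⟨fun i => ?_, ?_⟩
    · have := hx.1 i
      have := hy.1 i
      simp only [Pi.add_apply, Pi.smul_apply, smul_eq_mul]
      positivity
    · simp only [Pi.add_apply, Pi.smul_apply, smul_eq_mul, Finset.sum_add_distrib,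
        ← Finset.mul_sum]
      nlinarith [hx.2, hy.2]

theorem subset_cornerSimplex (d : ℕ) :
    {x : Fin d → ℝ | (∀ i, 0 ≤ x i) ∧ ∑ i, x i ≤ 1} ⊆ cornerSimplex d := by
  rintro x ⟨h0, h1⟩
  have h : ∑ j, (Fin.cons (1 - ∑ i, x i) x : Fin (d + 1) → ℝ) j •
      (Fin.cons 0 (fun i => Pi.single i 1) : Fin (d + 1) → Fin d → ℝ) j ∈ cornerSimplex d := by
    apply (convex_convexHull ℝ _).sum_mem
    · intro j _
      refine Fin.cases ?_ (fun i => ?_) j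
      · simpa using h1
      · simpa using h0 i
    · simp [Fin.sum_univ_succ]
    · exact fun j _ => subset_convexHull ℝ _ ⟨j, rfl⟩
  convert h using 1
  ext k
  simp [Fin.sum_univ_succ, Pi.single_apply]

theorem volume_signed_orthant_simplex (d : ℕ) (ε : Fin d → ℝ) (hε : ∀ i, |ε i| = 1) :
    volume {x : Fin d → ℝ | (∀ i, 0 < ε i * x i) ∧ ∑ i, |x i| ≤ 1} =
      volume {x : Fin d → ℝ | (∀ i, 0 < x i) ∧ ∑ i, |x i| ≤ 1} := by
  have hdet : LinearMap.det (Matrix.toLin' (Matrix.diagonal ε)) = ∏ i, ε i := by simp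
  have habs : |∏ i, ε i| = 1 := by
    rw [Finset.abs_prod]
    exact Finset.prod_eq_one fun i _ => hε i
  have hne : LinearMap.det (Matrix.toLin' (Matrix.diagonal ε)) ≠ 0 := by
    rw [hdet]
    intro h
    simp [h] at habs
  have := Measure.addHaar_preimage_linearMap volume hne
    {x : Fin d → ℝ | (∀ i, 0 < x i) ∧ ∑ i, |x i| ≤ 1}
  rw [hdet, abs_inv, habs] at this
  simp only [inv_one, ENNReal.ofReal_one, one_mul] at this
  rw [← this]
  congr 1
  ext x
  simp [Matrix.mulVec_diagonal, abs_mul, hε]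

/-- The `2 ^ d` open-orthant pieces of the ℓ¹ unit ball are disjoint and of equal volume, and the
ball has volume `2 ^ d / d!`. The corner simplex exceeds the positive piece only by null sets in
coordinate hyperplanes. -/
theorem volume_cornerSimplex_le (d : ℕ) :
    volume (cornerSimplex d) ≤ ENNReal.ofReal (1 / (d.factorial : ℝ)) := by
  rcases Nat.eq_zero_or_pos d with rfl | hd
  · refine (measure_mono (Set.subset_univ _)).trans ?_
    simp [volume_pi]
  have : Nonempty (Fin d) := ⟨⟨0, hd⟩⟩
  let V : (Fin d → Bool) → Set (Fin d → ℝ) := fun b =>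
    {x | (∀ i, 0 < (if b i then (1 : ℝ) else -1) * x i) ∧ ∑ i, |x i| ≤ 1}
  let U : Set (Fin d → ℝ) := {x | (∀ i, 0 < x i) ∧ ∑ i, |x i| ≤ 1}
  have hV : ∀ b, volume (V b) = volume U := fun b =>
    volume_signed_orthant_simplex d (fun i => if b i then (1 : ℝ) else -1)
      (fun i => by split_ifs <;> simp)
  have hmeas : ∀ b, MeasurableSet (V b) := by
    intro b
    have h1 : MeasurableSet {x : Fin d → ℝ | ∑ i, |x i| ≤ 1} :=
      (isClosed_le (by fun_prop) (by fun_prop)).measurableSet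
    have h2 : MeasurableSet {x : Fin d → ℝ | ∀ i, 0 < (if b i then (1 : ℝ) else -1) * x i} := by
      have : {x : Fin d → ℝ | ∀ i, 0 < (if b i then (1 : ℝ) else -1) * x i} =
          ⋂ i, {x : Fin d → ℝ | 0 < (if b i then (1 : ℝ) else -1) * x i} := by
        ext x
        simp
      rw [this]
      exact MeasurableSet.iInter fun i =>
        (isOpen_lt (by fun_prop) (by fun_prop)).measurableSet
    exact h2.inter h1
  have hdisj : Pairwise (Function.onFun Disjoint V) := by
    intro b c hbc
    rw [Function.onFun, Set.disjoint_left]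
    intro x hx hy
    apply hbc
    funext i
    have h1 := hx.1 i
    have h2 := hy.1 i
    cases hb : b i <;> cases hc : c i <;> simp [hb, hc] at h1 h2 ⊢ <;> linarith
  have hball : volume {x : Fin d → ℝ | (∑ i, |x i| ^ (1 : ℝ)) ^ (1 / (1 : ℝ)) ≤ 1} =
      ENNReal.ofReal (2 ^ d / d.factorial) := by
    rw [volume_sum_rpow_le (Fin d) le_rfl 1]
    have h2 : Real.Gamma (1 / 1 + 1) = 1 := by
      have := Real.Gamma_nat_eq_factorial 1
      norm_num at this ⊢
    rw [h2, Fintype.card_fin, div_one, Real.Gamma_nat_eq_factorial]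
    simp
  have hsum : (2 : ℝ≥0∞) ^ d * volume U ≤ ENNReal.ofReal (2 ^ d / d.factorial) := by
    rw [← hball]
    calc (2 : ℝ≥0∞) ^ d * volume U = ∑ b : Fin d → Bool, volume (V b) := by
          simp [hV]
      _ = volume (⋃ b, V b) := by
          rw [measure_iUnion hdisj hmeas, tsum_fintype]
      _ ≤ _ := by
          apply measure_mono
          intro x hx
          obtain ⟨b, hb⟩ := Set.mem_iUnion.1 hx
          simpa using hb.2
  have hU : volume U ≤ ENNReal.ofReal (1 / (d.factorial : ℝ)) := by
    have h2 : ENNReal.ofReal (2 ^ d / (d.factorial : ℝ)) =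
        2 ^ d * ENNReal.ofReal (1 / (d.factorial : ℝ)) := by
      rw [div_eq_mul_one_div, ENNReal.ofReal_mul (by positivity),
        ENNReal.ofReal_pow (by norm_num)]
      simp
    rw [h2] at hsum
    exact (ENNReal.mul_le_mul_iff_right (by simp) (by simp)).1 hsum
  have hsub : cornerSimplex d ⊆ U ∪ ⋃ i, {x : Fin d → ℝ | x i = 0} := by
    intro x hx
    obtain ⟨h0, h1⟩ := cornerSimplex_subset d hx
    by_cases h : ∃ i, x i = 0
    · right
      simpa using h
    · left
      push Not at h
      refine ⟨fun i => lt_of_le_of_ne (h0 i) (h i).symm, ?_⟩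
      simpa [abs_of_nonneg (h0 _)] using h1
  calc volume (cornerSimplex d) ≤ volume U + volume (⋃ i, {x : Fin d → ℝ | x i = 0}) :=
        (measure_mono hsub).trans (measure_union_le _ _)
    _ = volume U := by
        have h : volume (⋃ i, {x : Fin d → ℝ | x i = 0}) = 0 :=
          measure_iUnion_null fun i => Measure.pi_hyperplane (fun _ => volume) i 0
        rw [h, add_zero]
    _ ≤ _ := hU

theorem volume_cornerSimplex_pos (d : ℕ) : 0 < volume (cornerSimplex d) := by
  have hsub : Set.Icc (0 : Fin d → ℝ) (fun _ => 1 / ((d : ℝ) + 1)) ⊆ cornerSimplex d := by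
    intro x hx
    refine subset_cornerSimplex d ⟨fun i => hx.1 i, ?_⟩
    calc ∑ i, x i ≤ ∑ _i : Fin d, 1 / ((d : ℝ) + 1) := Finset.sum_le_sum fun i _ => hx.2 i
      _ ≤ 1 := by
        simp only [Finset.sum_const, Finset.card_univ, Fintype.card_fin, nsmul_eq_mul]
        rw [mul_one_div, div_le_one (by positivity)]
        linarith
  refine lt_of_lt_of_le ?_ (measure_mono hsub)
  rw [Real.volume_Icc_pi]
  refine CanonicallyOrderedAdd.prod_pos.2 fun i _ => ?_
  simp only [Pi.zero_apply, sub_zero, ENNReal.ofReal_pos]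
  positivity

/-! ### Simplex volumes as determinants -/

/-- The square matrix whose columns are the points `v j` with a coordinate `1` prepended. -/
def homogenization {d : ℕ} (v : Fin (d + 1) → Fin d → ℝ) :
    Matrix (Fin (d + 1)) (Fin (d + 1)) ℝ :=
  Matrix.of fun i j => (Fin.cons 1 (v j) : Fin (d + 1) → ℝ) i

theorem det_homogenization {d : ℕ} (v : Fin (d + 1) → Fin d → ℝ) :
    (homogenization v).det = (Matrix.of fun i j : Fin d => v j.succ i - v 0 i).det := by
  let B : Matrix (Fin (d + 1)) (Fin (d + 1)) ℝ := Matrix.of fun j i =>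
    homogenization v i j - (if j = 0 then 0 else 1) * homogenization v i 0
  have h1 : (homogenization v).transpose.det = B.det := by
    apply Matrix.det_eq_of_forall_row_eq_smul_add_const (fun j => if j = 0 then 0 else 1) 0
      (by simp)
    intro i j
    simp [B, Matrix.transpose_apply]
  rw [← Matrix.det_transpose, h1, ← Matrix.det_transpose, Matrix.det_succ_row_zero,
    Fin.sum_univ_succ, Finset.sum_eq_zero]
  · simp only [B, homogenization, Matrix.transpose_apply, Matrix.of_apply]
    simp only [Fin.val_zero, pow_zero, one_mul, if_true, Fin.cons_zero, add_zero, zero_mul,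
      sub_zero]
    congr 1
    ext i j
    simp [Matrix.submatrix, Fin.succAbove]
  · intro j _
    simp [B, homogenization]

open scoped Pointwise in
-- Any simplex is an affine image of the corner simplex; a degenerate tuple gives zero on both
-- sides.
theorem volume_convexHull_range {d : ℕ} (v : Fin (d + 1) → Fin d → ℝ) :
    volume (convexHull ℝ (Set.range v)) =
      ENNReal.ofReal |(homogenization v).det| * volume (cornerSimplex d) := by
  let M : Matrix (Fin d) (Fin d) ℝ := Matrix.of fun i j => v j.succ i - v 0 i
  have himg : convexHull ℝ (Set.range v) =
      (fun x => v 0 + x) '' (Matrix.toLin' M '' cornerSimplex d) := by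
    have h : ∀ S : Set (Fin d → ℝ), (fun x => v 0 + x) '' S = {v 0} + S := fun S => by simp
    rw [h, cornerSimplex, LinearMap.image_convexHull, ← Set.range_comp,
      ← convexHull_singleton (𝕜 := ℝ) (v 0), ← convexHull_add, ← h]
    congr 1
    ext y
    constructor
    · rintro ⟨j, rfl⟩
      refine ⟨_, ⟨j, rfl⟩, ?_⟩
      refine Fin.cases ?_ (fun i => ?_) j
      · simp
      · ext k
        simp [M]
    · rintro ⟨_, ⟨j, rfl⟩, rfl⟩
      refine ⟨j, ?_⟩
      refine Fin.cases ?_ (fun i => ?_) j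
      · simp
      · ext k
        simp [M]
  rw [himg, det_homogenization, Set.image_add_left, measure_preimage_add,
    Measure.addHaar_image_linearMap, LinearMap.det_toLin']

/-! ### Simplices indexed by tuples of columns -/

theorem Finset.exists_range_eq_of_card_le {α : Type*} (s : Finset α) (hs : s.Nonempty) {n : ℕ}
    (hn : s.card ≤ n) : ∃ v : Fin n → α, Set.range v = s := by
  have : Nonempty s := hs.to_subtype
  obtain ⟨e⟩ : Nonempty (s ↪ Fin n) := Function.Embedding.nonempty_of_card_le (by simpa using hn)
  refine ⟨fun i => (Function.invFun e i : s), ?_⟩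
  rw [show (fun i => ((Function.invFun e i : s) : α)) = Subtype.val ∘ Function.invFun e from rfl,
    (Function.invFun_surjective e.injective).range_comp]
  simp

/-- Affine independence allows at most `d + 1` points; with fewer, the tuple repeats some of them.
-/
theorem AffineIndependent.exists_tuple_range_eq {ι : Type*} {d : ℕ} (p : ι → Fin d → ℝ)
    (s : Finset (Fin d → ℝ)) (hs : s.Nonempty) (hi : AffineIndependent ℝ ((↑) : s → Fin d → ℝ))
    (hsub : (s : Set (Fin d → ℝ)) ⊆ Set.range p) :
    ∃ τ : Fin (d + 1) → ι, Set.range (p ∘ τ) = s := by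
  have hcard : s.card ≤ d + 1 := by
    have h := hi.card_le_finrank_succ
    have h2 := Submodule.finrank_le (vectorSpan ℝ (Set.range ((↑) : s → Fin d → ℝ)))
    simp only [Module.finrank_fin_fun, Fintype.card_coe] at h h2
    omega
  obtain ⟨v, hv⟩ := s.exists_range_eq_of_card_le hs hcard
  have : ∀ j, ∃ i, p i = v j := fun j => hsub (hv ▸ ⟨j, rfl⟩)
  choose τ hτ using this
  exact ⟨τ, by rw [← hv]; congr 1; funext j; exact hτ j⟩

/-- Carathéodory's theorem, with lower-dimensional simplices padded to tuples. -/
theorem convexHull_range_subset_iUnion_tuples {ι : Type*} {d : ℕ} (p : ι → Fin d → ℝ) :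
    convexHull ℝ (Set.range p) ⊆
      ⋃ τ : Fin (d + 1) → ι, convexHull ℝ (Set.range (p ∘ τ)) := by
  rw [convexHull_eq_union]
  simp only [Set.iUnion_subset_iff]
  intro s hsub hi x hx
  have hs : s.Nonempty := by
    rw [← Finset.coe_nonempty, ← convexHull_nonempty_iff (𝕜 := ℝ)]
    exact ⟨x, hx⟩
  obtain ⟨τ, hτ⟩ := hi.exists_tuple_range_eq p s hs hsub
  exact Set.mem_iUnion.2 ⟨τ, hτ ▸ hx⟩

/-! ### Valuations at infinity -/

theorem logAbs_of_ne_zero {x : ℝ} (hx : x ≠ 0) : logAbs x = (Real.log x : ℝ) := by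
  rw [logAbs, ENNReal.log_ofReal_of_pos (abs_pos.2 hx), Real.log_abs]

theorem logAbs_zero : logAbs 0 = ⊥ := by simp [logAbs]

theorem logAbs_mono {x y : ℝ} (h : |x| ≤ |y|) : logAbs x ≤ logAbs y :=
  ENNReal.log_monotone (ENNReal.ofReal_le_ofReal h)

theorem abs_lt_of_logAbs_lt {x y : ℝ} (h : logAbs x < logAbs y) : |x| < |y| := by
  by_contra! h'
  exact absurd (logAbs_mono h') (not_le.2 h)

theorem HasVal.of_eventually_zero {f : ℝ → ℝ} (h : ∀ᶠ t in atTop, f t = 0) : HasVal f ⊥ := by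
  refine Tendsto.congr' ?_ tendsto_const_nhds
  filter_upwards [h, eventually_gt_atTop 1] with t ht h1
  rw [ht, logAbs_zero, EReal.bot_div_of_pos_ne_top]
  · exact_mod_cast Real.log_pos h1
  · exact EReal.coe_ne_top _

theorem HasVal.const_mul_rpow {c : ℝ} (hc : 0 < c) (r : ℝ) :
    HasVal (fun t => c * t ^ r) (r : EReal) := by
  have h1 : Tendsto (fun t : ℝ => Real.log c / Real.log t + r) atTop (𝓝 r) := by
    simpa using (tendsto_const_nhds.div_atTop Real.tendsto_log_atTop).add
      (tendsto_const_nhds (x := r))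
  refine Tendsto.congr' ?_ ((continuous_coe_real_ereal.tendsto r).comp h1)
  filter_upwards [eventually_gt_atTop 1] with t ht
  have ht0 : 0 < t := by linarith
  have hlog := Real.log_pos ht
  rw [Function.comp_apply, logAbs_of_ne_zero (by positivity), ← EReal.coe_div,
    Real.log_mul hc.ne' (by positivity), Real.log_rpow ht0]
  congr 1
  field_simp

theorem eventually_logAbs_div_le {f g : ℝ → ℝ} (h : ∀ᶠ t in atTop, |f t| ≤ |g t|) :
    ∀ᶠ t in atTop, logAbs (f t) / ((Real.log t : ℝ) : EReal) ≤
      logAbs (g t) / ((Real.log t : ℝ) : EReal) := by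
  filter_upwards [h, eventually_gt_atTop 1] with t ht h1
  exact EReal.div_le_div_right_of_nonneg (by exact_mod_cast (Real.log_pos h1).le) (logAbs_mono ht)

theorem HasVal.mono {f g : ℝ → ℝ} {a b : EReal} (hf : HasVal f a) (hg : HasVal g b)
    (h : ∀ᶠ t in atTop, |f t| ≤ |g t|) : a ≤ b :=
  le_of_tendsto_of_tendsto hf hg (eventually_logAbs_div_le h)

theorem HasVal.squeeze {f g h : ℝ → ℝ} {a : EReal} (hf : HasVal f a) (hh : HasVal h a)
    (hfg : ∀ᶠ t in atTop, |f t| ≤ |g t|) (hgh : ∀ᶠ t in atTop, |g t| ≤ |h t|) : HasVal g a :=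
  tendsto_of_tendsto_of_tendsto_of_le_of_le' hf hh (eventually_logAbs_div_le hfg)
    (eventually_logAbs_div_le hgh)

theorem HasVal.eventually_abs_le_pow {f : ℝ → ℝ} {a : EReal} (hf : HasVal f a) {n : ℕ}
    (h : a < n) : ∀ᶠ t in atTop, |f t| ≤ t ^ n := by
  have hg : Tendsto (fun t : ℝ => ((n : ℝ) : EReal)) atTop (𝓝 n) := tendsto_const_nhds
  filter_upwards [hf.eventually_lt hg h, eventually_gt_atTop 1] with t ht h1
  have ht0 : 0 < t := by linarith
  have hlog := Real.log_pos h1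
  have key : logAbs (f t) < logAbs (t ^ n) := by
    rw [logAbs_of_ne_zero (x := t ^ n) (by positivity), Real.log_pow, EReal.coe_mul]
    exact (EReal.div_lt_iff (by exact_mod_cast hlog) (EReal.coe_ne_top _)).1 ht
  have := abs_lt_of_logAbs_lt key
  rw [abs_of_pos (pow_pos ht0 n)] at this
  exact this.le

/-! ### Functions of power growth -/

/-- A function is of power type if, for large arguments, it vanishes or lies between two positive
multiples of a power of the variable. -/
def IsPowerType (f : ℝ → ℝ) : Prop :=
  (∀ᶠ t in atTop, f t = 0) ∨
    ∃ r a b : ℝ, 0 < a ∧ ∀ᶠ t in atTop, a * t ^ r ≤ f t ∧ f t ≤ b * t ^ r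

theorem IsPowerType.eventually_nonneg {f : ℝ → ℝ} (hf : IsPowerType f) :
    ∀ᶠ t in atTop, 0 ≤ f t := by
  rcases hf with h | ⟨r, a, b, ha, h⟩
  · filter_upwards [h] with t ht using ht.ge
  · filter_upwards [h, eventually_gt_atTop 0] with t ht h0
    exact (by positivity : 0 ≤ a * t ^ r).trans ht.1

theorem eventually_add_between_rpow {f g : ℝ → ℝ} {r s a b c e : ℝ} (ha : 0 < a) (hrs : r ≤ s)
    (hf : ∀ᶠ t in atTop, a * t ^ r ≤ f t ∧ f t ≤ b * t ^ r)
    (hg : ∀ᶠ t in atTop, c * t ^ s ≤ g t ∧ g t ≤ e * t ^ s) :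
    ∀ᶠ t in atTop, c * t ^ s ≤ f t + g t ∧ f t + g t ≤ (|b| + e) * t ^ s := by
  filter_upwards [hf, hg, eventually_ge_atTop 1] with t h1 h2 ht
  have hp : (0 : ℝ) < t ^ r := by positivity
  have hpow : t ^ r ≤ t ^ s := Real.rpow_le_rpow_of_exponent_le ht hrs
  have hb : b * t ^ r ≤ |b| * t ^ s := mul_le_mul (le_abs_self b) hpow hp.le (abs_nonneg b)
  have ha' : 0 < a * t ^ r := by positivity
  constructor
  · linarith [h1.1, h2.1]
  · linarith [h1.2, h2.2]

/-- The lower constants are positive, so there is no cancellation and the larger exponent wins. -/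
theorem IsPowerType.add {f g : ℝ → ℝ} (hf : IsPowerType f) (hg : IsPowerType g) :
    IsPowerType (fun t => f t + g t) := by
  rcases hf with hf | ⟨r, a, b, ha, hf⟩ <;> rcases hg with hg | ⟨s, c, e, hc, hg⟩
  · left
    filter_upwards [hf, hg] with t h1 h2
    rw [h1, h2, add_zero]
  · right
    refine ⟨s, c, e, hc, ?_⟩
    filter_upwards [hf, hg] with t h1 h2
    rwa [h1, zero_add]
  · right
    refine ⟨r, a, b, ha, ?_⟩
    filter_upwards [hf, hg] with t h1 h2
    rwa [h2, add_zero]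
  · right
    rcases le_total r s with hrs | hrs
    · exact ⟨s, c, _, hc, eventually_add_between_rpow ha hrs hf hg⟩
    · refine ⟨r, a, |e| + b, ha, ?_⟩
      simpa only [add_comm] using eventually_add_between_rpow hc hrs hg hf

theorem IsPowerType.sum {ι : Type*} (s : Finset ι) (f : ι → ℝ → ℝ)
    (hf : ∀ i ∈ s, IsPowerType (f i)) : IsPowerType (fun t => ∑ i ∈ s, f i t) := by
  classical
  induction s using Finset.induction_on with
  | empty => left; simp
  | insert i s hi ih =>
    simp only [Finset.sum_insert hi]
    exact (hf i (by simp)).add (ih fun j hj => hf j (by simp [hj]))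

theorem IsPowerType.of_comparable {f g : ℝ → ℝ} (hf : IsPowerType f) {a b : ℝ} (ha : 0 < a)
    (hb : 0 ≤ b) (h1 : ∀ᶠ t in atTop, a * f t ≤ g t) (h2 : ∀ᶠ t in atTop, g t ≤ b * f t) :
    IsPowerType g := by
  rcases hf with hf | ⟨r, c, e, hc, hf⟩
  · left
    filter_upwards [hf, h1, h2] with t h h1 h2
    rw [h] at h1 h2
    linarith
  · right
    refine ⟨r, a * c, b * e, by positivity, ?_⟩
    filter_upwards [hf, h1, h2] with t h h1 h2
    constructor
    · nlinarith [mul_le_mul_of_nonneg_left h.1 ha.le]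
    · nlinarith [mul_le_mul_of_nonneg_left h.2 hb]

theorem IsPowerType.exists_hasVal {f : ℝ → ℝ} (hf : IsPowerType f) : ∃ a, HasVal f a := by
  have hf0 := hf.eventually_nonneg
  rcases hf with hf | ⟨r, a, b, ha, hf⟩
  · exact ⟨⊥, HasVal.of_eventually_zero hf⟩
  · refine ⟨r, (HasVal.const_mul_rpow ha r).squeeze
      (HasVal.const_mul_rpow (c := |b| + 1) (by positivity) r) ?_ ?_⟩
    · filter_upwards [hf, hf0, eventually_gt_atTop 0] with t h h0 ht
      rw [abs_of_nonneg h0, abs_of_pos (by positivity)]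
      exact h.1
    · filter_upwards [hf, hf0, eventually_gt_atTop 0] with t h h0 ht
      rw [abs_of_nonneg h0, abs_of_pos (by positivity)]
      have : (0 : ℝ) < t ^ r := by positivity
      nlinarith [h.2, le_abs_self b]

/-- The absolute value of a finite sum of monomials with real exponents is of power type. -/
theorem isPowerType_abs_sum_rpow {ι : Type*} [Fintype ι] (c r : ι → ℝ) :
    IsPowerType (fun t => |∑ i, c i * t ^ r i|) := by
  classical
  let S := Finset.univ.image r
  let C : ℝ → ℝ := fun x => ∑ i with r i = x, c i
  have hsum : ∀ t : ℝ, ∑ i, c i * t ^ r i = ∑ x ∈ S, C x * t ^ x := by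
    intro t
    rw [← Finset.sum_fiberwise_of_maps_to (s := Finset.univ) (t := S) (g := r)
      (fun i hi => Finset.mem_image_of_mem r hi)]
    refine Finset.sum_congr rfl fun x _ => ?_
    rw [Finset.sum_mul]
    refine Finset.sum_congr rfl fun i hi => ?_
    rw [(Finset.mem_filter.1 hi).2]
  simp only [hsum]
  -- Equal exponents are already merged; discarding those whose coefficients cancel makes the
  -- largest remaining one the true growth rate.
  have hfilter : ∀ t : ℝ, ∑ x ∈ S, C x * t ^ x = ∑ x ∈ S with C x ≠ 0, C x * t ^ x := by
    intro t
    rw [Finset.sum_filter_of_ne]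
    intro x _ h hC
    simp [hC] at h
  simp only [hfilter]
  set S' := S.filter fun x => C x ≠ 0 with hS'
  rcases S'.eq_empty_or_nonempty with h | h
  · left
    simp [h]
  · right
    set ρ := S'.max' h with hρ
    have hρS : ρ ∈ S' := S'.max'_mem h
    have hCρ : C ρ ≠ 0 := (Finset.mem_filter.1 hρS).2
    have hlim : Tendsto (fun t : ℝ => |∑ x ∈ S', C x * t ^ (x - ρ)|) atTop (𝓝 |C ρ|) := by
      have h1 : Tendsto (fun t : ℝ => ∑ x ∈ S', C x * t ^ (x - ρ)) atTop
          (𝓝 (∑ x ∈ S', if x = ρ then C ρ else 0)) := by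
        refine tendsto_finsetSum _ fun x hx => ?_
        split_ifs with hxr
        · subst hxr
          simp
        · have hlt : x < ρ := lt_of_le_of_ne (S'.le_max' x hx) hxr
          have := (tendsto_rpow_neg_atTop (y := ρ - x) (by linarith)).const_mul (C x)
          simpa using this
      rw [Finset.sum_ite_eq' S' ρ, if_pos hρS] at h1
      exact h1.abs
    have hpos : 0 < |C ρ| := abs_pos.2 hCρ
    refine ⟨ρ, |C ρ| / 2, 2 * |C ρ|, by positivity, ?_⟩
    filter_upwards [hlim.eventually_const_le (show |C ρ| / 2 < |C ρ| by linarith),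
      hlim.eventually_le_const (show |C ρ| < 2 * |C ρ| by linarith),
      eventually_gt_atTop 0] with t h1 h2 ht
    have hp : (0 : ℝ) < t ^ ρ := by positivity
    have heq : |∑ x ∈ S', C x * t ^ x| = |∑ x ∈ S', C x * t ^ (x - ρ)| * t ^ ρ := by
      have : ∑ x ∈ S', C x * t ^ x = (∑ x ∈ S', C x * t ^ (x - ρ)) * t ^ ρ := by
        rw [Finset.sum_mul]
        refine Finset.sum_congr rfl fun x _ => ?_
        rw [mul_assoc, ← Real.rpow_add ht, sub_add_cancel]
      rw [this, abs_mul, abs_of_pos hp]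
    rw [heq]
    exact ⟨mul_le_mul_of_nonneg_right h1 hp.le, mul_le_mul_of_nonneg_right h2 hp.le⟩

/-! ### Finiteness of the upper dequantized volume -/

theorem exists_nat_logAbs_lt {d m : ℕ} (A : Matrix (Fin d) (Fin m) ℝ) :
    ∃ n : ℕ, ∀ i j, matrixLog A i j < n := by
  have h : ∀ i j, ∀ᶠ n : ℕ in atTop, matrixLog A i j < n := by
    intro i j
    rw [matrixLog, Matrix.map_apply]
    by_cases h0 : A i j = 0
    · rw [h0, logAbs_zero]
      exact Eventually.of_forall fun n => EReal.bot_lt_coe (n : ℝ)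
    · rw [logAbs_of_ne_zero h0]
      filter_upwards [(tendsto_natCast_atTop_atTop (R := ℝ)).eventually_gt_atTop
        (Real.log (A i j))] with n hn
      exact_mod_cast hn
  exact (eventually_all.2 fun i => eventually_all.2 (h i)).exists

theorem volume_convColumns_le_of_abs_le {d m : ℕ} (M : Matrix (Fin d) (Fin m) ℝ) {r : ℝ}
    (h : ∀ i j, |M i j| ≤ r) : volume (convColumns M) ≤ ENNReal.ofReal (2 * r) ^ d := by
  have hsub : convColumns M ⊆ Set.Icc (fun _ => -r) (fun _ => r) := by
    apply convexHull_min _ (convex_Icc _ _)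
    rintro _ ⟨j, rfl⟩
    exact ⟨fun i => (abs_le.1 (h i j)).1, fun i => (abs_le.1 (h i j)).2⟩
  refine (measure_mono hsub).trans ?_
  rw [Real.volume_Icc_pi]
  simp [two_mul]

theorem volume_convColumns_lt_top {d m : ℕ} (M : Matrix (Fin d) (Fin m) ℝ) :
    volume (convColumns M) < ⊤ := by
  refine (volume_convColumns_le_of_abs_le M (r := ∑ i, ∑ j, |M i j|) fun i j => ?_).trans_lt
    (ENNReal.pow_lt_top ENNReal.ofReal_lt_top)
  refine (Finset.single_le_sum (f := fun j => |M i j|) (fun j _ => abs_nonneg _)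
    (Finset.mem_univ j)).trans ?_
  exact Finset.single_le_sum (f := fun i => ∑ j, |M i j|)
    (fun i _ => Finset.sum_nonneg fun j _ => abs_nonneg _) (Finset.mem_univ i)

theorem qvolPlus_matrixLog_lt_top {d m : ℕ} (K : Subring (Germ (atTop : Filter ℝ) ℝ))
    (A : Matrix (Fin d) (Fin m) ℝ) : qvolPlus K (matrixLog A) < ⊤ := by
  obtain ⟨n, hn⟩ := exists_nat_logAbs_lt A
  -- The columns lie in a cube of side `2 * t ^ n`, which is at most `t ^ (n + 1)` once `t ≥ 2`.
  refine lt_of_le_of_lt (sSup_le ?_) (EReal.coe_lt_top (((n + 1) * d : ℕ) : ℝ))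
  rintro a ⟨F, hF, ha⟩
  refine ha.mono (HasVal.const_mul_rpow one_pos (((n + 1) * d : ℕ) : ℝ)) ?_
  have hb : ∀ᶠ t in atTop, ∀ i j, |F t i j| ≤ t ^ n :=
    eventually_all.2 fun i => eventually_all.2 fun j =>
      (hF i j).2.2.eventually_abs_le_pow (hn i j)
  filter_upwards [hb, eventually_ge_atTop 2] with t ht h2
  rw [one_mul, Real.rpow_natCast, abs_of_nonneg ENNReal.toReal_nonneg,
    abs_of_nonneg (by positivity), pow_mul]
  have hle : volume (convColumns (F t)) ≤ ENNReal.ofReal ((2 * t ^ n) ^ d) := by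
    rw [ENNReal.ofReal_pow (by positivity)]
    exact volume_convColumns_le_of_abs_le (F t) ht
  refine (ENNReal.toReal_le_of_le_ofReal (by positivity) hle).trans ?_
  gcongr
  rw [pow_succ, mul_comm]
  gcongr

/-! ### Monomial lifts and the valuation of their volume -/

/-- The parametric matrix of monomials with coefficients `k` whose exponents are the logarithms of
the entries of `A`. -/
noncomputable def monomialFamily {d m : ℕ} (A : Matrix (Fin d) (Fin m) ℝ)
    (k : Fin d → Fin m → ℝ) (t : ℝ) : Matrix (Fin d) (Fin m) ℝ :=
  Matrix.of fun i j => k i j * t ^ Real.log (A i j)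

/-- Since `Real.log 0 = 0`, the power at a zero entry is `1`, and only a zero coefficient gives
valuation `⊥`. -/
theorem isLift_monomialFamily {d m : ℕ} {K : Subring (Germ (atTop : Filter ℝ) ℝ)}
    (hK : ∀ r : ℝ, ((fun t : ℝ => t ^ r : ℝ → ℝ) : Germ (atTop : Filter ℝ) ℝ) ∈ K)
    (A : Matrix (Fin d) (Fin m) ℝ) (c : Fin d → Fin m → ℕ) (hc : ∀ i j, c i j = 0 ↔ A i j = 0) :
    IsLift K (monomialFamily A fun i j => (c i j : ℝ)) (matrixLog A) := by
  intro i j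
  refine ⟨?_, ?_, ?_⟩
  · exact K.mul_mem (natCast_mem K (c i j)) (hK (Real.log (A i j)))
  · filter_upwards [eventually_gt_atTop 0] with t ht
    simp only [monomialFamily, Matrix.of_apply]
    positivity
  · simp only [monomialFamily, Matrix.of_apply, matrixLog, Matrix.map_apply]
    by_cases h : A i j = 0
    · rw [h, logAbs_zero, (hc i j).2 h]
      exact HasVal.of_eventually_zero (by simp)
    · rw [logAbs_of_ne_zero h]
      have : c i j ≠ 0 := fun h' => h ((hc i j).1 h')
      exact HasVal.const_mul_rpow (by positivity) _

theorem det_homogenization_rpow {d : ℕ} (k e : Fin (d + 1) → Fin d → ℝ) {t : ℝ} (ht : 0 < t) :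
    (homogenization fun j i => k j i * t ^ e j i).det =
      ∑ σ : Equiv.Perm (Fin (d + 1)),
        ((Equiv.Perm.sign σ : ℤ) : ℝ) * (∏ j, homogenization k (σ j) j) *
          t ^ ∑ j, (Fin.cons 0 (e j) : Fin (d + 1) → ℝ) (σ j) := by
  rw [Matrix.det_apply']
  refine Finset.sum_congr rfl fun σ _ => ?_
  rw [mul_assoc, Real.rpow_sum_of_pos ht, ← Finset.prod_mul_distrib]
  congr 1
  refine Finset.prod_congr rfl fun j _ => ?_
  simp only [homogenization, Matrix.of_apply]
  refine Fin.cases ?_ (fun i => ?_) (σ j) <;> simp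

theorem isPowerType_abs_det_homogenization {d m : ℕ} (A : Matrix (Fin d) (Fin m) ℝ)
    (k : Fin d → Fin m → ℝ) (τ : Fin (d + 1) → Fin m) :
    IsPowerType (fun t => |(homogenization ((monomialFamily A k t).col ∘ τ)).det|) := by
  have h := isPowerType_abs_sum_rpow
    (fun σ : Equiv.Perm (Fin (d + 1)) => ((Equiv.Perm.sign σ : ℤ) : ℝ) *
      ∏ j, homogenization (fun j i => k i (τ j)) (σ j) j)
    (fun σ => ∑ j, (Fin.cons 0 (fun i => Real.log (A i (τ j))) : Fin (d + 1) → ℝ) (σ j))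
  have heq : ∀ᶠ t in atTop, |(homogenization ((monomialFamily A k t).col ∘ τ)).det| =
      |∑ σ : Equiv.Perm (Fin (d + 1)), (((Equiv.Perm.sign σ : ℤ) : ℝ) *
      ∏ j, homogenization (fun j i => k i (τ j)) (σ j) j) *
        t ^ ∑ j, (Fin.cons 0 (fun i => Real.log (A i (τ j))) : Fin (d + 1) → ℝ) (σ j)| := by
    filter_upwards [eventually_gt_atTop 0] with t ht
    rw [← det_homogenization_rpow _ _ ht]
    rfl
  refine h.of_comparable one_pos zero_le_one ?_ ?_
  · filter_upwards [heq] with t ht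
    rw [ht, one_mul]
  · filter_upwards [heq] with t ht
    rw [ht, one_mul]

theorem mul_abs_det_le_volume_convColumns {d m : ℕ} (M : Matrix (Fin d) (Fin m) ℝ)
    (τ : Fin (d + 1) → Fin m) :
    (volume (cornerSimplex d)).toReal * |(homogenization (M.col ∘ τ)).det| ≤
      (volume (convColumns M)).toReal := by
  have hsub : convexHull ℝ (Set.range (M.col ∘ τ)) ⊆ convColumns M :=
    convexHull_mono (Set.range_comp_subset_range _ _)
  have := ENNReal.toReal_mono (volume_convColumns_lt_top M).ne (measure_mono hsub)
  rw [volume_convexHull_range, ENNReal.toReal_mul, ENNReal.toReal_ofReal (abs_nonneg _)] at this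
  rwa [mul_comm]

theorem volume_convColumns_le_sum_abs_det {d m : ℕ} (M : Matrix (Fin d) (Fin m) ℝ) :
    (volume (convColumns M)).toReal ≤ (volume (cornerSimplex d)).toReal *
      ∑ τ : Fin (d + 1) → Fin m, |(homogenization (M.col ∘ τ)).det| := by
  have hfin : volume (cornerSimplex d) ≠ ⊤ :=
    ((volume_cornerSimplex_le d).trans_lt ENNReal.ofReal_lt_top).ne
  have h := (measure_mono (μ := volume) (convexHull_range_subset_iUnion_tuples M.col)).trans
    (measure_iUnion_fintype_le volume _)
  simp only [volume_convexHull_range] at h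
  have h2 := ENNReal.toReal_mono (by
    refine (ENNReal.sum_lt_top.2 fun τ _ => ?_).ne
    exact ENNReal.mul_lt_top ENNReal.ofReal_lt_top hfin.lt_top) h
  rw [ENNReal.toReal_sum fun τ _ => (ENNReal.mul_lt_top ENNReal.ofReal_lt_top hfin.lt_top).ne]
    at h2
  rw [mul_comm, Finset.sum_mul]
  simpa [ENNReal.toReal_mul, convColumns] using h2

/-- The volume lies between the average and the sum of the simplex volumes over all tuples, up to
constants, and that sum is of power type. -/
theorem exists_hasVal_volume_monomialFamily {d m : ℕ} (A : Matrix (Fin d) (Fin m) ℝ)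
    (k : Fin d → Fin m → ℝ) :
    ∃ a, HasVal (fun t => (volume (convColumns (monomialFamily A k t))).toReal) a := by
  have hpos : 0 < (volume (cornerSimplex d)).toReal := ENNReal.toReal_pos
    (volume_cornerSimplex_pos d).ne'
    ((volume_cornerSimplex_le d).trans_lt ENNReal.ofReal_lt_top).ne
  have hG := IsPowerType.sum Finset.univ
    (fun (τ : Fin (d + 1) → Fin m) t => |(homogenization ((monomialFamily A k t).col ∘ τ)).det|)
    (fun τ _ => isPowerType_abs_det_homogenization A k τ)
  -- The `+ 1` keeps `N` positive when there are no columns, hence no tuples.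
  set N : ℝ := (Fintype.card (Fin (d + 1) → Fin m) : ℝ) + 1
  have hN : 0 < N := by positivity
  refine (hG.of_comparable (a := (volume (cornerSimplex d)).toReal / N) (by positivity) hpos.le
    (Eventually.of_forall fun t => ?_)
    (Eventually.of_forall fun t => volume_convColumns_le_sum_abs_det _)).exists_hasVal
  rw [div_mul_eq_mul_div, div_le_iff₀ hN, Finset.mul_sum]
  refine (Finset.sum_le_sum fun τ _ => mul_abs_det_le_volume_convColumns _ τ).trans ?_
  rw [Finset.sum_const, Finset.card_univ, nsmul_eq_mul, mul_comm]
  gcongr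
  simp [N]

/-! ### The optimal permutation and its boosted lift -/

/-- The other terms together are at most `(n - 1) / n` of the dominant one, where `n` is the number
of terms. -/
theorem le_abs_sum_of_dominant {ι : Type*} [Fintype ι] [DecidableEq ι] (s x : ι → ℝ)
    (hs : ∀ i, |s i| = 1) (hx : ∀ i, 0 ≤ x i) (i₀ : ι)
    (h : ∀ i, i ≠ i₀ → (Fintype.card ι : ℝ) * x i ≤ x i₀) :
    x i₀ / Fintype.card ι ≤ |∑ i, s i * x i| := by
  have hN : (0 : ℝ) < Fintype.card ι := by exact_mod_cast Fintype.card_pos_iff.2 ⟨i₀⟩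
  have habs : ∀ i, |s i * x i| = x i := fun i => by
    rw [abs_mul, hs, one_mul, abs_of_nonneg (hx i)]
  have h1 : |∑ i ∈ Finset.univ.erase i₀, s i * x i| ≤
      ((Fintype.card ι : ℝ) - 1) * (x i₀ / Fintype.card ι) := by
    refine (Finset.abs_sum_le_sum_abs _ _).trans ?_
    calc ∑ i ∈ Finset.univ.erase i₀, |s i * x i|
        ≤ ∑ _i ∈ Finset.univ.erase i₀, x i₀ / Fintype.card ι := by
          refine Finset.sum_le_sum fun i hi => ?_
          rw [habs, le_div_iff₀ hN, mul_comm]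
          exact h i (Finset.ne_of_mem_erase hi)
      _ = _ := by
          rw [Finset.sum_const, Finset.card_erase_of_mem (Finset.mem_univ _), nsmul_eq_mul,
            Finset.card_univ, Nat.cast_sub (Fintype.card_pos_iff.2 ⟨i₀⟩), Nat.cast_one]
  rw [← Finset.add_sum_erase _ _ (Finset.mem_univ i₀)]
  have h2 := abs_sub_abs_le_abs_sub (s i₀ * x i₀) (-∑ i ∈ Finset.univ.erase i₀, s i * x i)
  rw [abs_neg, sub_neg_eq_add, habs] at h2
  have h3 : x i₀ = (Fintype.card ι : ℝ) * (x i₀ / Fintype.card ι) := by field_simp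
  nlinarith

/-- Distinct permutations differ in at least two places, and `ρ` takes the value `0` at only one of
them. Row `0` of ones cannot be boosted, so a disagreement in another row is needed. -/
theorem Equiv.Perm.exists_ne_apply_ne {n : ℕ} {σ ρ : Equiv.Perm (Fin (n + 1))} (h : σ ≠ ρ) :
    ∃ j, σ j ≠ ρ j ∧ ρ j ≠ 0 := by
  by_contra! hc
  apply h
  ext1 j
  by_contra hj
  have h0 := hc j hj
  have h1 : ρ (ρ.symm (σ j)) = σ j := by simp
  by_cases h2 : σ (ρ.symm (σ j)) = ρ (ρ.symm (σ j))
  · rw [h1] at h2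
    have := σ.injective h2
    rw [this] at h1
    exact hj h1.symm
  · have := hc _ h2
    rw [h1] at this
    exact hj (this.trans h0.symm)

/-- A nonzero product is required: `Real.log 0 = 0` would turn a zero factor into `1`. -/
theorem prod_homogenization_eq_exp {d : ℕ} (v : Fin (d + 1) → Fin d → ℝ)
    (hv : ∀ j i, 0 ≤ v j i) (σ : Fin (d + 1) → Fin (d + 1))
    (h : ∏ j, homogenization v (σ j) j ≠ 0) :
    ∏ j, homogenization v (σ j) j =
      Real.exp (∑ j, (Fin.cons 0 (fun i => Real.log (v j i)) : Fin (d + 1) → ℝ) (σ j)) := by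
  rw [Real.exp_sum]
  refine Finset.prod_congr rfl fun j hj => ?_
  have h0 := Finset.prod_ne_zero_iff.1 h j hj
  simp only [homogenization, Matrix.of_apply] at h0 ⊢
  revert h0
  refine Fin.cases ?_ (fun i => ?_) (σ j)
  · simp
  · simp only [Fin.cons_succ]
    exact fun h0 => (Real.exp_log (lt_of_le_of_ne (hv j i) (Ne.symm h0))).symm

theorem log_prod_homogenization_le_qvolPlus {d m : ℕ}
    {K : Subring (Germ (atTop : Filter ℝ) ℝ)}
    (hK : ∀ r : ℝ, ((fun t : ℝ => t ^ r : ℝ → ℝ) : Germ (atTop : Filter ℝ) ℝ) ∈ K)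
    (A : Matrix (Fin d) (Fin m) ℝ) (hA : ∀ i j, 0 ≤ A i j) (τ : Fin (d + 1) → Fin m)
    (hτ : Function.Injective τ) (ρ : Equiv.Perm (Fin (d + 1)))
    (hmax : ∀ σ : Equiv.Perm (Fin (d + 1)),
      ∏ j, homogenization (A.col ∘ τ) (σ j) j ≤ ∏ j, homogenization (A.col ∘ τ) (ρ j) j)
    (hpos : 0 < ∏ j, homogenization (A.col ∘ τ) (ρ j) j) :
    ((Real.log (∏ j, homogenization (A.col ∘ τ) (ρ j) j) : ℝ) : EReal) ≤
      qvolPlus K (matrixLog A) := by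
  classical
  let N : ℕ := Fintype.card (Equiv.Perm (Fin (d + 1)))
  have hN : 1 ≤ N := Fintype.card_pos
  have hN' : (1 : ℝ) ≤ N := by exact_mod_cast hN
  -- Nonzero entries chosen by `ρ` get weight `N = (d + 1)!`, the number of Leibniz terms.
  -- Injectivity of `τ` keeps the boost off the other entries of the submatrix.
  let c : Fin d → Fin m → ℕ := fun i l =>
    if A i l = 0 then 0 else if ∃ j, τ j = l ∧ ρ j = i.succ then N else 1
  have hc : ∀ i j, c i j = 0 ↔ A i j = 0 := by
    intro i j
    by_cases h : A i j = 0
    · simp [c, h]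
    · simp only [c, h, if_false, iff_false]
      split_ifs
      · exact Nat.one_le_iff_ne_zero.1 hN
      · exact not_false
  let k : Fin d → Fin m → ℝ := fun i l => (c i l : ℝ)
  obtain ⟨a, ha⟩ := exists_hasVal_volume_monomialFamily A k
  have hlift : IsLift K (monomialFamily A k) (matrixLog A) := isLift_monomialFamily hK A c hc
  refine le_trans ?_ (le_sSup ⟨monomialFamily A k, hlift, ha⟩)
  set w := ∑ j, (Fin.cons 0 (fun i => Real.log (A i (τ j))) : Fin (d + 1) → ℝ) (ρ j) with hw
  have hexp : ∀ σ : Equiv.Perm (Fin (d + 1)), ∏ j, homogenization (A.col ∘ τ) (σ j) j ≠ 0 →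
      ∏ j, homogenization (A.col ∘ τ) (σ j) j =
      Real.exp (∑ j, (Fin.cons 0 (fun i => Real.log (A i (τ j))) : Fin (d + 1) → ℝ) (σ j)) :=
    fun σ h => prod_homogenization_eq_exp (A.col ∘ τ) (fun j i => hA i (τ j)) σ h
  rw [hexp ρ hpos.ne', Real.log_exp, ← hw]
  -- the entries of the homogenized coefficient matrix
  let g : Fin (d + 1) → Fin (d + 1) → ℝ := fun i j => homogenization (fun j i => k i (τ j)) i j
  have hg0 : ∀ j, g 0 j = 1 := fun j => rfl
  have hgs : ∀ i j, g i.succ j = (c i (τ j) : ℝ) := fun i j => rfl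
  have hg_nonneg : ∀ i j, 0 ≤ g i j := by
    intro i j
    refine Fin.cases ?_ (fun i => ?_) i
    · rw [hg0]
      norm_num
    · rw [hgs]
      positivity
  have hg_off : ∀ i j, ρ j ≠ i → g i j ≤ 1 := by
    intro i j
    refine Fin.cases ?_ (fun i => ?_) i
    · intro _
      rw [hg0]
    · intro h
      rw [hgs]
      have : ¬ ∃ j', τ j' = τ j ∧ ρ j' = i.succ := by
        rintro ⟨j', h1, h2⟩
        exact h (hτ h1 ▸ h2)
      simp only [c, this, if_false]
      split_ifs <;> simp
  have hAρ : ∀ j i, ρ j = Fin.succ i → A i (τ j) ≠ 0 := by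
    intro j i h h0
    have := Finset.prod_ne_zero_iff.1 hpos.ne' j (Finset.mem_univ j)
    rw [h] at this
    exact this h0
  have hg_on : ∀ j, ρ j ≠ 0 → g (ρ j) j = N := by
    intro j h
    obtain ⟨i, hi⟩ := Fin.exists_succ_eq.2 h
    rw [← hi, hgs]
    have h1 : ∃ j', τ j' = τ j ∧ ρ j' = i.succ := ⟨j, rfl, hi.symm⟩
    simp only [c, hAρ j i hi.symm, h1, if_false, if_true]
  have hg_on_ge : ∀ j, 1 ≤ g (ρ j) j := by
    intro j
    by_cases h : ρ j = 0
    · rw [h, hg0]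
    · rw [hg_on j h]
      exact hN'
  -- At `j₁` the permutation `σ` misses a boosted entry and loses a factor `N`; elsewhere it gains
  -- nothing over `ρ`.
  have hdom : ∀ σ : Equiv.Perm (Fin (d + 1)), σ ≠ ρ → N * ∏ j, g (σ j) j ≤ ∏ j, g (ρ j) j := by
    intro σ hσ
    obtain ⟨j₁, h1, h2⟩ := Equiv.Perm.exists_ne_apply_ne hσ
    rw [← Finset.mul_prod_erase _ _ (Finset.mem_univ j₁),
      ← Finset.mul_prod_erase _ (fun j => g (ρ j) j) (Finset.mem_univ j₁), ← mul_assoc]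
    refine mul_le_mul ?_ ?_ (Finset.prod_nonneg fun j _ => hg_nonneg _ _) (hg_nonneg _ _)
    · rw [hg_on j₁ h2]
      exact mul_le_of_le_one_right (by positivity) (hg_off _ _ h1.symm)
    · refine Finset.prod_le_prod (fun j _ => hg_nonneg _ _) fun j _ => ?_
      by_cases h : ρ j = σ j
      · rw [h]
      · exact (hg_off _ _ h).trans (hg_on_ge j)
  have hκ : 0 < (volume (cornerSimplex d)).toReal := ENNReal.toReal_pos
    (volume_cornerSimplex_pos d).ne'
    ((volume_cornerSimplex_le d).trans_lt ENNReal.ofReal_lt_top).ne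
  refine (HasVal.const_mul_rpow
    (show 0 < (volume (cornerSimplex d)).toReal / N by positivity) w).mono ha ?_
  filter_upwards [eventually_ge_atTop 1] with t ht
  have ht0 : 0 < t := by linarith
  rw [abs_of_nonneg (by positivity), abs_of_nonneg ENNReal.toReal_nonneg]
  refine le_trans ?_ (mul_abs_det_le_volume_convColumns _ τ)
  rw [div_mul_eq_mul_div, mul_div_assoc]
  refine mul_le_mul_of_nonneg_left ?_ hκ.le
  have hdet : (homogenization ((monomialFamily A k t).col ∘ τ)).det =
      ∑ σ : Equiv.Perm (Fin (d + 1)), ((Equiv.Perm.sign σ : ℤ) : ℝ) * ((∏ j, g (σ j) j) *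
        t ^ ∑ j, (Fin.cons 0 (fun i => Real.log (A i (τ j))) : Fin (d + 1) → ℝ) (σ j)) := by
    simp only [← mul_assoc]
    exact det_homogenization_rpow (fun j i => k i (τ j)) (fun j i => Real.log (A i (τ j))) ht0
  rw [hdet]
  refine le_trans ?_ (le_abs_sum_of_dominant _ _ (fun σ => ?_) (fun σ => ?_) ρ (fun σ hσ => ?_))
  · rw [← hw]
    refine div_le_div_of_nonneg_right ?_ (by positivity)
    refine le_mul_of_one_le_left (by positivity) ?_
    exact Finset.one_le_prod (fun j _ => hg_on_ge j)
  · rcases Int.units_eq_one_or (Equiv.Perm.sign σ) with h | h <;> simp [h]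
  · exact mul_nonneg (Finset.prod_nonneg fun j _ => hg_nonneg _ _) (by positivity)
  -- A vanishing product in `A` says nothing about the exponent of `t`, but its coefficient product
  -- vanishes as well.
  · by_cases h0 : ∏ j, homogenization (A.col ∘ τ) (σ j) j = 0
    · have hz : ∏ j, g (σ j) j = 0 := by
        obtain ⟨j, _, hj⟩ := Finset.prod_eq_zero_iff.1 h0
        refine Finset.prod_eq_zero (Finset.mem_univ j) ?_
        revert hj
        refine Fin.cases ?_ (fun i => ?_) (σ j)
        · simp [homogenization]
        · intro h
          rw [hgs, (hc i (τ j)).2 h, Nat.cast_zero]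
      rw [hz, zero_mul, mul_zero]
      exact mul_nonneg (Finset.prod_nonneg fun j _ => hg_nonneg _ _) (by positivity)
    · rw [← mul_assoc]
      refine mul_le_mul (hdom σ hσ) ?_ (by positivity)
        (Finset.prod_nonneg fun j _ => hg_nonneg _ _)
      refine Real.rpow_le_rpow_of_exponent_le ht ?_
      have := hmax σ
      rwa [hexp σ h0, hexp ρ hpos.ne', Real.exp_le_exp] at this

/-! ### Bounding one simplex -/

/-- The factor `d + 1` is `(d + 1)! / d!`: the number of Leibniz terms times the volume of the
corner simplex. -/
theorem volume_simplex_le_exp_qvolPlus {d m : ℕ} {K : Subring (Germ (atTop : Filter ℝ) ℝ)}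
    (hK : ∀ r : ℝ, ((fun t : ℝ => t ^ r : ℝ → ℝ) : Germ (atTop : Filter ℝ) ℝ) ∈ K)
    (A : Matrix (Fin d) (Fin m) ℝ) (hA : ∀ i j, 0 ≤ A i j) (τ : Fin (d + 1) → Fin m) :
    volume (convexHull ℝ (Set.range (A.col ∘ τ))) ≤
      ((d : ℝ≥0∞) + 1) * EReal.exp (qvolPlus K (matrixLog A)) := by
  rw [volume_convexHull_range]
  set H := homogenization (A.col ∘ τ) with hH
  by_cases hdet : H.det = 0
  · simp [hdet]
  have hτ : Function.Injective τ := by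
    intro i j hij
    by_contra hne
    apply hdet
    refine Matrix.det_zero_of_column_eq hne fun l => ?_
    simp [hH, homogenization, hij]
  have hnn : ∀ i j, 0 ≤ H i j := by
    intro i j
    simp only [hH, homogenization, Matrix.of_apply]
    refine Fin.cases ?_ (fun i => ?_) i
    · simp
    · simpa using hA i (τ j)
  obtain ⟨ρ, -, hmax⟩ := Finset.exists_max_image (Finset.univ : Finset (Equiv.Perm (Fin (d + 1))))
    (fun σ => ∏ j, H (σ j) j) Finset.univ_nonempty
  set P := ∏ j, H (ρ j) j with hP
  have hdetle : |H.det| ≤ (d + 1).factorial * P := by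
    rw [Matrix.det_apply']
    refine (Finset.abs_sum_le_sum_abs _ _).trans ?_
    refine (Finset.sum_le_sum (g := fun _ => P) fun σ _ => ?_).trans ?_
    · rw [abs_mul, abs_of_nonneg (Finset.prod_nonneg fun j _ => hnn _ _)]
      refine le_trans (le_of_eq ?_) (hmax σ (Finset.mem_univ σ))
      rcases Int.units_eq_one_or (Equiv.Perm.sign σ) with h | h <;> simp [h]
    · rw [Finset.sum_const, Finset.card_univ, Fintype.card_perm, Fintype.card_fin, nsmul_eq_mul]
  have hPpos : 0 < P := by
    have h1 := (abs_pos.2 hdet).trans_le hdetle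
    exact pos_of_mul_pos_right h1 (by positivity)
  have hle := log_prod_homogenization_le_qvolPlus hK A hA τ hτ ρ
    (fun σ => hmax σ (Finset.mem_univ σ)) hPpos
  have hexp : ENNReal.ofReal P ≤ EReal.exp (qvolPlus K (matrixLog A)) := by
    refine le_trans (le_of_eq ?_) (EReal.exp_monotone hle)
    rw [EReal.exp_coe, Real.exp_log hPpos]
  calc ENNReal.ofReal |H.det| * volume (cornerSimplex d)
      ≤ ENNReal.ofReal ((d + 1).factorial * P) * ENNReal.ofReal (1 / (d.factorial : ℝ)) := by
        gcongr
        exact volume_cornerSimplex_le d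
    _ = ((d : ℝ≥0∞) + 1) * ENNReal.ofReal P := by
        rw [← ENNReal.ofReal_mul (by positivity)]
        have : ((d + 1).factorial : ℝ) * P * (1 / (d.factorial : ℝ)) = ((d : ℝ) + 1) * P := by
          rw [Nat.factorial_succ]
          push_cast
          field_simp
        rw [this, ENNReal.ofReal_mul (by positivity), ENNReal.ofReal_add (by positivity) one_pos.le]
        simp
    _ ≤ _ := by gcongr

/-! ### Summing over the triangulation -/

theorem IsTriangulation.finite_faces {d m : ℕ} {A : Matrix (Fin d) (Fin m) ℝ}
    {T : Geometry.SimplicialComplex ℝ (Fin d → ℝ)} (hT : IsTriangulation A T) :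
    T.faces.Finite := by
  refine Set.Finite.subset (((Set.finite_range A.col).finite_subsets).preimage
    Finset.coe_injective.injOn) fun s hs => ?_
  refine Set.Subset.trans ?_ hT.1
  rw [Geometry.SimplicialComplex.vertices_eq]
  exact Set.subset_biUnion_of_mem (u := fun s : Finset (Fin d → ℝ) => (s : Set (Fin d → ℝ))) hs

/-- Finiteness guarantees that every face lies in a maximal one. -/
theorem Geometry.SimplicialComplex.space_subset_biUnion_facets {E : Type*} [AddCommGroup E]
    [Module ℝ E] (T : Geometry.SimplicialComplex ℝ E) (hT : T.faces.Finite) :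
    T.space ⊆ ⋃ s ∈ T.facets, convexHull ℝ (s : Set E) := by
  intro x hx
  obtain ⟨s, hs, hxs⟩ := mem_space_iff.1 hx
  obtain ⟨t, hst, ht⟩ := hT.exists_le_maximal hs
  refine Set.mem_biUnion (x := t) ⟨ht.prop, fun u hu htu => ht.eq_of_le hu htu⟩ ?_
  exact convexHull_mono (by exact_mod_cast hst) hxs

theorem mainTheorem7 (L : FirstOrder.Language.{u, v}) [L.Structure ℝ]
    (hL : IsOMinimalRealExpansion L) (hLb : IsPolynomiallyBounded L)
    (K : Subring (Germ (atTop : Filter ℝ) ℝ)) (hK : IsDefinableHardyField L K)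
    (d m : ℕ) (A : Matrix (Fin d) (Fin m) ℝ) (hA : ∀ i j, 0 ≤ A i j)
    (T : Geometry.SimplicialComplex ℝ (Fin d → ℝ)) (hT : IsTriangulation A T) :
    qvolPlus K (matrixLog A) < ⊤ ∧ T.facets.Finite ∧
      volume (convColumns A) ≤
        (T.facets.ncard : ℝ≥0∞) * ((d : ℝ≥0∞) + 1) * EReal.exp (qvolPlus K (matrixLog A)) := by
  have hfin : T.facets.Finite := hT.finite_faces.subset T.facets_subset
  refine ⟨qvolPlus_matrixLog_lt_top K A, hfin, ?_⟩
  rw [← hT.2]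
  calc volume T.space ≤ volume (⋃ s ∈ hfin.toFinset, convexHull ℝ (s : Set (Fin d → ℝ))) := by
        apply measure_mono
        simpa using T.space_subset_biUnion_facets hT.finite_faces
    _ ≤ ∑ s ∈ hfin.toFinset, volume (convexHull ℝ (s : Set (Fin d → ℝ))) :=
        measure_biUnion_finset_le _ _
    _ ≤ ∑ _s ∈ hfin.toFinset, ((d : ℝ≥0∞) + 1) * EReal.exp (qvolPlus K (matrixLog A)) := by
        refine Finset.sum_le_sum fun s hs => ?_
        have hs' : s ∈ T.faces := T.facets_subset (hfin.mem_toFinset.1 hs)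
        have hsub : (s : Set (Fin d → ℝ)) ⊆ Set.range A.col := by
          refine Set.Subset.trans ?_ hT.1
          rw [Geometry.SimplicialComplex.vertices_eq]
          exact Set.subset_biUnion_of_mem
            (u := fun s : Finset (Fin d → ℝ) => (s : Set (Fin d → ℝ))) hs'
        obtain ⟨τ, hτ⟩ := (T.indep hs').exists_tuple_range_eq A.col s
          (T.nonempty_of_mem_faces hs') hsub
        rw [← hτ]
        exact volume_simplex_le_exp_qvolPlus hK.rpow_mem A hA τ
    _ = _ := by
        rw [Finset.sum_const, nsmul_eq_mul, Set.ncard_eq_toFinset_card _ hfin, mul_assoc]
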